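/- **Definitions.** A *Polish structure* $(X,G)$ is a Polish group $G$ acting faithfully on a set $X$ so that the stabilizer of each point is closed in $G$. It is *small* if for every $n\in\omega$ there are only countably many $G$-orbits on $X^n$. A *compact $G$-group* is a Polish structure $(H,G)$ in which $G$ acts continuously and by automorphisms on a compact (Hausdorff) group $H$. For finite $A\subseteq X$ let $G_A$ be the pointwise stabilizer of $A$, and for a finite tuple $a$ from $X$ let $o(a/A)=\{ga:g\in G_A\}$. For finite $A,B\subseteq X$, $a$ is *$nm$-independent* from $B$ over $A$ if $\{g\in G_A: ga\in o(a/A\cup B)\}$ is non-meager in $G_A$, and *$nm$-dependent* otherwise. The rank $\mathcal{NM}(a/A)$, an ordinal or $\infty$, is determined by: $\mathcal{NM}(a/A)\ge\alpha+1$ iff there is a finite $B\supseteq A$ such that $a$ is $nm$-dependent on $B$ over $A$ and $\mathcal{NM}(a/B)\ge\alpha$. Put $\mathcal{NM}(X)=\sup_{x\in X}\mathcal{NM}(x/\emptyset)$. A small $(X,G)$ is *$nm$-stable* if $\mathcal{NM}(X)<\infty$. A subgroup of $H$ is *$\emptyset$-closed* if it is closed and $G$-invariant. **Theorem.** Let $p$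 be a prime number and let $\alpha<\omega_1$ be an ordinal. There is a small, $nm$-stable compact $G$-group $(H,G)$ such that $H$ is abelian and $\mathcal{NM}(H)=\alpha$; if $\alpha>0$, one can take $H=\mathbb{Z}_p^{\omega}$, where $\mathbb{Z}_p$ is the cyclic group of order $p$ and $H$ carries the product topology. Moreover, $H$ has $\emptyset$-closed subgroups $H_i$, $i\le\alpha$, such that $H_i\le H_j$ and $H_i$ is nowhere dense in $H_j$ whenever $i<j\le\alpha$. Consequently, both of the following assertions are false: 1. ($\mathcal{NM}$-gap conjecture, restricted to small, $nm$-stable compact $G$-groups; hence also the conjecture for all small Polish structures.) For every small, $nm$-stable compact $G$-group $(H,G)$, every finite tuple $a$ from $H$ and every finite $A\subseteq H$, the rank $\mathcal{NM}(a/A)$ is a finite ordinal or $\infty$. 2. (Ascending chain condition.) For every small, $nm$-stable compact $G$-group $(H,G)$, every ascending sequence $K_0\le K_1\le\cdots$ of $\emptyset$-closed subgroups of $H$ is eventually constant. -/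

import Mathlib

/-! # Polish structures, `nm`-independence, the rank `NM`, and compact `G`-groups -/

universe u v w

open scoped Ordinal

namespace PolishStr

section Independence

variable (G : Type v) {X : Type u} {Y : Type w} [Group G] [MulAction G X] [MulAction G Y]

/-- `orbitOver G a A` is `o(a/A) = {g • a : g ∈ G_A}`, the orbit of `a` over `A ⊆ X`, where `G_A` is
the pointwise stabilizer of `A`.  Here `a` is an element of any `G`-set `Y`; in the applications
`Y` is `X` itself, or `Fin n → X` (finite tuples) with the diagonal action. -/
def orbitOver (a : Y) (A : Set X) : Set Y :=
  {y | ∃ g ∈ fixingSubgroup G A, g • a = y}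

variable [TopologicalSpace G]

/-- `a` is `nm`-independent from `B` over `A`: with `π_A : G_A → o(a/A)`, `g ↦ g • a`, the set
`π_A⁻¹[o(a/AB)]` is non-meager in `π_A⁻¹[o(a/A)] = G_A` (with the subspace topology). -/
def NMIndep (a : Y) (A B : Set X) : Prop :=
  ¬ IsMeagre {g : fixingSubgroup G A | (g : G) • a ∈ orbitOver G a (A ∪ B)}

/-- `NMGe G a β A` says `NM(a/A) ≥ β`: for each `γ < β` there is a finite `B ⊇ A` such that `a` is
`nm`-dependent on `B` over `A` and `NM(a/B) ≥ γ`. -/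
def NMGe (a : Y) (β : Ordinal.{u}) (A : Set X) : Prop :=
  ∀ γ, γ < β → ∃ B : Set X, B.Finite ∧ A ⊆ B ∧ ¬ NMIndep G a A B ∧ NMGe a γ B
termination_by β

/-- The rank `NM(a/A)`, an ordinal or `∞ = ⊤`: the supremum of all `β` with `NM(a/A) ≥ β`. -/
noncomputable def NM (a : Y) (A : Set X) : WithTop Ordinal.{u} :=
  sSup ((fun β : Ordinal.{u} => (β : WithTop Ordinal.{u})) '' {β | NMGe G a β A})

variable (X) in
/-- The rank `NM(X)`, the supremum of `NM(x/∅)` over `x ∈ X`. -/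
noncomputable def NMSpace : WithTop Ordinal.{u} :=
  ⨆ x : X, NM G x (∅ : Set X)

variable {G}

theorem NMGe.mono {a : Y} {A : Set X} {β γ : Ordinal.{u}} (h : NMGe G a β A) (hγ : γ ≤ β) :
    NMGe G a γ A := by
  rw [NMGe] at h ⊢
  exact fun δ hδ => h δ (hδ.trans_le hγ)

/-- The order on ranks given by `NM` is the one given by `NMGe`. -/
theorem le_NM_iff {a : Y} {A : Set X} {β : Ordinal.{u}} :
    (β : WithTop Ordinal.{u}) ≤ NM G a A ↔ NMGe G a β A := by
  constructor
  · intro h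
    rw [NMGe]
    intro γ hγ
    have h1 : (γ : WithTop Ordinal.{u}) < NM G a A :=
      lt_of_lt_of_le (WithTop.coe_lt_coe.2 hγ) h
    obtain ⟨_, ⟨δ, hδ, rfl⟩, h2⟩ := lt_sSup_iff.1 h1
    have hδ' : NMGe G a δ A := hδ
    rw [NMGe] at hδ'
    exact hδ' γ (WithTop.coe_lt_coe.1 h2)
  · intro h
    exact le_sSup ⟨β, h, rfl⟩

/-- The recursive condition that characterizes the rank `NM`. -/
theorem succ_le_NM_iff {a : Y} {A : Set X} {β : Ordinal.{u}} :
    ((Order.succ β : Ordinal.{u}) : WithTop Ordinal.{u}) ≤ NM G a A ↔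
      ∃ B : Set X, B.Finite ∧ A ⊆ B ∧ ¬ NMIndep G a A B ∧
        (β : WithTop Ordinal.{u}) ≤ NM G a B := by
  simp only [le_NM_iff]
  constructor
  · intro h
    rw [NMGe] at h
    exact h β (Order.lt_succ β)
  · rintro ⟨B, hB, hAB, hd, hr⟩
    rw [NMGe]
    exact fun γ hγ => ⟨B, hB, hAB, hd, hr.mono (Order.lt_succ_iff.1 hγ)⟩

end Independence

section Structures

variable (G : Type v) (X : Type u) [Group G] [TopologicalSpace G]

/-- `(X, G)` is a Polish structure: `G` is a Polish group acting faithfully on the set `X` so that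
the stabilizers of all points are closed. -/
structure IsPolishStructure [MulAction G X] : Prop where
  isTopologicalGroup : IsTopologicalGroup G
  polishSpace : PolishSpace G
  faithful : FaithfulSMul G X
  isClosed_stabilizer : ∀ x : X, IsClosed (MulAction.stabilizer G x : Set G)

/-- `(X, G)` is small: `G` has only countably many orbits on each `X ^ n`. -/
def IsSmall [MulAction G X] : Prop :=
  ∀ n : ℕ, Countable (MulAction.orbitRel.Quotient G (Fin n → X))

/-- `(X, G)` is `nm`-stable: `NM(X) < ∞`. -/
def IsNMStable [MulAction G X] : Prop :=
  NMSpace G X < ⊤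

variable (H : Type u) [AddGroup H] [TopologicalSpace H] [DistribMulAction G H]

/-- `(H, G)` is a compact `G`-group: a Polish structure in which `G` acts continuously and by
automorphisms on the compact (Hausdorff) group `H`, here written additively. -/
structure IsCompactGGroup : Prop extends IsPolishStructure G H where
  isTopologicalAddGroup : IsTopologicalAddGroup H
  compactSpace : CompactSpace H
  t2Space : T2Space H
  continuousSMul : ContinuousSMul G H

variable {H}

/-- The subgroup `K` of `H` is `∅`-closed: closed and invariant under `G`. -/
def IsEmptyClosed (K : AddSubgroup H) : Prop :=
  IsClosed (K : Set H) ∧ ∀ g : G, (fun x : H => g • x) '' (K : Set H) = (K : Set H)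

end Structures

/-- `K` is a subgroup of `L`, nowhere dense in the subspace topology of `L`. -/
def NwdSubgroup {H : Type u} [AddGroup H] [TopologicalSpace H] (K L : AddSubgroup H) : Prop :=
  K ≤ L ∧ IsNowhereDense {x : L | (x : H) ∈ K}

/-- The `NM`-gap conjecture for small, `nm`-stable compact `G`-groups: the rank of every orbit (of a
finite tuple over a finite set) is a finite ordinal or `∞`.  (The full conjecture asserts this for
every small Polish structure, so it implies the present statement.) -/
def NMGapConjecture : Prop :=
  ∀ (H G : Type) [AddGroup H] [TopologicalSpace H] [Group G] [TopologicalSpace G]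
    [DistribMulAction G H],
    IsCompactGGroup G H → IsSmall G H → IsNMStable G H →
      ∀ (n : ℕ) (a : Fin n → H) (A : Set H), A.Finite →
        NM G a A < ((ω : Ordinal.{0}) : WithTop Ordinal.{0}) ∨ NM G a A = ⊤

/-- The ascending chain condition on `∅`-closed subgroups, for all small, `nm`-stable compact
`G`-groups: every ascending sequence of such subgroups stabilizes. -/
def EmptyClosedACC : Prop :=
  ∀ (H G : Type) [AddGroup H] [TopologicalSpace H] [Group G] [TopologicalSpace G]
    [DistribMulAction G H],
    IsCompactGGroup G H → IsSmall G H → IsNMStable G H →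
      ∀ K : ℕ → AddSubgroup H, Monotone K → (∀ n, IsEmptyClosed G (K n)) →
        ∃ N, ∀ n, N ≤ n → K n = K N

end PolishStr

/-! Let `V` be the `𝔽_p`-space with basis `I = α × ω`, filtered by the subspaces `V_β` spanned by
the basis vectors of level at least `β`. Take for `H` the dual `𝔽_p^I` of `V`, for `G` the filtered
automorphisms of `V`, and for `H_β` the annihilator of `V_β`. The `H_β` increase with `β`, from `0`
to `H_α = H`.

Since every level is infinite, a back-and-forth argument shows that the orbit of a finite tuple of
functionals is determined by which of its linear combinations lie in which `H_β`
(`SameType.exists_smul_eq`). As `α` is countable, this leaves countably many orbits.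

Let `r` be the least `β` with `a ∈ span A + H_β`, that is, `depRank`. Transvections close to `1`
that fix `A` push `a` out of any coset of `H_β` with `β < r`, so a generic element of `G_A` makes
`a` avoid countably many such cosets (`isNowhereDense_smul_sub_mem`). By homogeneity, `a` is
therefore independent from `B` over `A` exactly when `r` does not drop (`nmIndep_iff`). Adjoining `a
+ x`, with `x ∈ H_γ` generic, lowers `r` to any prescribed `γ < r` (`exists_depRank_insert_eq`).
Hence `NM(a/A) = r`, and `r = α` for generic `a` over `∅`.

The value `α = ω + 1` refutes the gap conjecture. The chain of the `H_n` inside `H_ω` refutes the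
ascending chain condition. -/

namespace FilteredDual

open Set Topology Filter

/-! ### The filtered vector space `I →₀ 𝔽_p` and its dual `I → 𝔽_p` -/

section Filtration

variable {I : Type} {p : ℕ}

/-- The evaluation pairing between the dual `I → 𝔽_p` and `I →₀ 𝔽_p`. -/
noncomputable def pairing (p : ℕ) (x : I → ZMod p) : (I →₀ ZMod p) →ₗ[ZMod p] ZMod p :=
  Finsupp.linearCombination (ZMod p) x

@[simp]
theorem pairing_single (x : I → ZMod p) (k : I) (c : ZMod p) :
    pairing p x (Finsupp.single k c) = c * x k := by
  simp [pairing]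

@[simp]
theorem pairing_add (x y : I → ZMod p) (v : I →₀ ZMod p) :
    pairing p (x + y) v = pairing p x v + pairing p y v := by
  simp [pairing, Finsupp.linearCombination_apply, Finsupp.sum, mul_add, Finset.sum_add_distrib]

@[simp]
theorem pairing_smul (c : ZMod p) (x : I → ZMod p) (v : I →₀ ZMod p) :
    pairing p (c • x) v = c * pairing p x v := by
  simp [pairing, Finsupp.linearCombination_apply, Finsupp.sum, Finset.mul_sum, mul_left_comm]

@[simp]
theorem pairing_zero (v : I →₀ ZMod p) : pairing p (0 : I → ZMod p) v = 0 := by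
  simp [pairing]

@[simp]
theorem pairing_sub (x y : I → ZMod p) (v : I →₀ ZMod p) :
    pairing p (x - y) v = pairing p x v - pairing p y v := by
  simp [pairing, Finsupp.linearCombination_apply, Finsupp.sum, mul_sub]

theorem pairing_sum {ι : Type*} (s : Finset ι) (x : ι → I → ZMod p) (v : I →₀ ZMod p) :
    pairing p (∑ i ∈ s, x i) v = ∑ i ∈ s, pairing p (x i) v := by
  classical
  induction s using Finset.induction_on with
  | empty => simp
  | insert a s ha ih => simp [Finset.sum_insert ha, ih]

theorem continuous_pairing (v : I →₀ ZMod p) : Continuous fun x : I → ZMod p => pairing p x v := by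
  simp only [pairing, Finsupp.linearCombination_apply, Finsupp.sum, smul_eq_mul]
  fun_prop

theorem pairing_injective {v w : I →₀ ZMod p} (h : ∀ x, pairing p x v = pairing p x w) :
    v = w := by
  classical
  have key : ∀ (u : I →₀ ZMod p) k, pairing p (Pi.single k 1) u = u k := by
    intro u k
    simp [pairing, Finsupp.linearCombination_apply, Finsupp.sum, Pi.single_apply]
    exact fun h => h.symm
  ext k
  rw [← key, h, key]

variable (lev : I → Ordinal.{0}) (p)

/-- The vectors supported on the indices of level at least `β`. -/
def levelGE (β : Ordinal.{0}) : Submodule (ZMod p) (I →₀ ZMod p) where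
  carrier := {v | ∀ k, lev k < β → v k = 0}
  zero_mem' := by simp
  add_mem' := by
    intro a b ha hb k hk
    simp [ha k hk, hb k hk]
  smul_mem' := by
    intro c a ha k hk
    simp [ha k hk]

/-- The functionals vanishing on `levelGE p lev β`. -/
def annih (β : Ordinal.{0}) : Submodule (ZMod p) (I → ZMod p) where
  carrier := {x | ∀ k, β ≤ lev k → x k = 0}
  zero_mem' := by simp
  add_mem' := by
    intro a b ha hb k hk
    simp [ha k hk, hb k hk]
  smul_mem' := by
    intro c a ha k hk
    simp [ha k hk]

variable {p lev}

theorem mem_levelGE {β : Ordinal.{0}} {v : I →₀ ZMod p} :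
    v ∈ levelGE p lev β ↔ ∀ k, lev k < β → v k = 0 := Iff.rfl

theorem mem_annih {β : Ordinal.{0}} {x : I → ZMod p} :
    x ∈ annih p lev β ↔ ∀ k, β ≤ lev k → x k = 0 := Iff.rfl

theorem levelGE_anti {β γ : Ordinal.{0}} (h : β ≤ γ) : levelGE p lev γ ≤ levelGE p lev β :=
  fun _ hv k hk => hv k (hk.trans_le h)

theorem annih_mono {β γ : Ordinal.{0}} (h : β ≤ γ) : annih p lev β ≤ annih p lev γ :=
  fun _ hx k hk => hx k (h.trans hk)

theorem single_mem_levelGE {β : Ordinal.{0}} {k : I} (c : ZMod p) (h : β ≤ lev k) :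
    Finsupp.single k c ∈ levelGE p lev β := by
  classical
  intro j hj
  rw [Finsupp.single_apply, if_neg]
  rintro rfl
  exact absurd hj (not_lt.2 h)

/-- The form of `annih` that does not mention coordinates; it makes invariance under filtered
automorphisms visible. -/
theorem mem_annih_iff_pairing {β : Ordinal.{0}} {x : I → ZMod p} :
    x ∈ annih p lev β ↔ ∀ v ∈ levelGE p lev β, pairing p x v = 0 := by
  constructor
  · intro hx v hv
    rw [pairing, Finsupp.linearCombination_apply]
    refine Finset.sum_eq_zero fun k _ => ?_
    rcases lt_or_ge (lev k) β with h | h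
    · simp [hv k h]
    · simp [hx k h]
  · intro h k hk
    simpa using h _ (single_mem_levelGE 1 hk)

theorem isClosed_annih (β : Ordinal.{0}) : IsClosed (annih p lev β : Set (I → ZMod p)) := by
  have : (annih p lev β : Set (I → ZMod p)) = ⋂ k, ⋂ (_ : β ≤ lev k), {x | x k = 0} := by
    ext x
    simp [mem_annih]
  rw [this]
  exact isClosed_iInter fun k => isClosed_iInter fun _ =>
    isClosed_eq (continuous_apply k) continuous_const

end Filtration

/-! ### The group of filtered automorphisms -/

section Group

variable {I : Type} (p : ℕ) (lev : I → Ordinal.{0})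

/-- Vectors carry the discrete topology. -/
instance : TopologicalSpace (I →₀ ZMod p) := ⊥

instance : DiscreteTopology (I →₀ ZMod p) := ⟨rfl⟩

/-- The monoid of linear endomorphisms preserving the filtration. -/
def filteredEnd : Submonoid (Module.End (ZMod p) (I →₀ ZMod p)) where
  carrier := {f | ∀ β, ∀ v ∈ levelGE p lev β, f v ∈ levelGE p lev β}
  one_mem' := by simp
  mul_mem' := by
    intro f g hf hg β v hv
    exact hf β _ (hg β v hv)

/-- The group of linear automorphisms preserving the filtration. -/
abbrev FilteredAut : Type := (filteredEnd p lev)ˣ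

/-- Evaluation embeds the monoid of filtered endomorphisms into a product of discrete spaces. -/
noncomputable def evalFun (f : filteredEnd p lev) : (I →₀ ZMod p) → (I →₀ ZMod p) := fun v => f.1 v

/-- The topology of pointwise convergence. -/
noncomputable instance : TopologicalSpace (filteredEnd p lev) := .induced (evalFun p lev) inferInstance

theorem isEmbedding_evalFun : IsEmbedding (evalFun p lev) := by
  refine ⟨⟨rfl⟩, fun f g h => ?_⟩
  ext1
  exact LinearMap.ext fun v => congrFun h v

/-- Each condition, linearity or preservation of the filtration, involves finitely many values in a
discrete space, hence is closed. -/
theorem isClosed_range_evalFun : IsClosed (range (evalFun p lev)) := by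
  have : range (evalFun p lev) = {f | (∀ v w, f (v + w) = f v + f w) ∧
      (∀ (c : ZMod p) v, f (c • v) = c • f v) ∧
      ∀ β, ∀ v ∈ levelGE p lev β, f v ∈ levelGE p lev β} := by
    ext f
    constructor
    · rintro ⟨g, rfl⟩
      exact ⟨map_add g.1, map_smul g.1, g.2⟩
    · rintro ⟨h1, h2, h3⟩
      exact ⟨⟨⟨⟨f, h1⟩, h2⟩, h3⟩, rfl⟩
  rw [this]
  have hc : ∀ v, Continuous fun f : (I →₀ ZMod p) → (I →₀ ZMod p) => f v := continuous_apply
  refine IsClosed.and ?_ (IsClosed.and ?_ ?_)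
  · simp only [ofPred_forall]
    refine isClosed_iInter fun v => isClosed_iInter fun w => isClosed_eq (hc _) ?_
    exact (continuous_of_discreteTopology (f := fun q : (I →₀ ZMod p) × (I →₀ ZMod p) =>
      q.1 + q.2)).comp ((hc v).prodMk (hc w))
  · simp only [ofPred_forall]
    refine isClosed_iInter fun c => isClosed_iInter fun w => isClosed_eq (hc _) ?_
    exact (continuous_of_discreteTopology (f := fun q : I →₀ ZMod p => c • q)).comp (hc w)
  · simp only [ofPred_forall]
    refine isClosed_iInter fun β => isClosed_iInter fun v => isClosed_iInter fun _ => ?_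
    exact (isClosed_discrete (levelGE p lev β : Set (I →₀ ZMod p))).preimage (hc v)

theorem isClosedEmbedding_evalFun : IsClosedEmbedding (evalFun p lev) :=
  ⟨isEmbedding_evalFun p lev, isClosed_range_evalFun p lev⟩

variable {p lev}

theorem continuous_eval (v : I →₀ ZMod p) : Continuous fun f : filteredEnd p lev => f.1 v :=
  (continuous_apply v).comp (isEmbedding_evalFun p lev).continuous

theorem continuous_into_filteredEnd {T : Type*} [TopologicalSpace T] {f : T → filteredEnd p lev}
    (h : ∀ v, Continuous fun t => (f t).1 v) : Continuous f :=
  (isEmbedding_evalFun p lev).continuous_iff.2 (continuous_pi h)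

instance : ContinuousMul (filteredEnd p lev) where
  continuous_mul := by
    refine continuous_into_filteredEnd fun v => ?_
    have h : Continuous fun q : filteredEnd p lev × (I →₀ ZMod p) => q.1.1 q.2 :=
      continuous_prod_of_discrete_right.2 fun v => continuous_eval v
    exact h.comp (continuous_fst.prodMk ((continuous_eval v).comp continuous_snd))

instance [Countable I] [NeZero p] : PolishSpace (filteredEnd p lev) :=
  have : Countable (I →₀ ZMod p) := inferInstance
  have : PolishSpace (I →₀ ZMod p) := inferInstance
  have : PolishSpace ((I →₀ ZMod p) → I →₀ ZMod p) := inferInstance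
  (isClosedEmbedding_evalFun p lev).polishSpace

instance [Countable I] [NeZero p] : PolishSpace (FilteredAut p lev) := by
  have : PolishSpace (filteredEnd p lev)ᵐᵒᵖ :=
    (MulOpposite.opHomeomorph (M := filteredEnd p lev)).symm.isClosedEmbedding.polishSpace
  refine IsClosedEmbedding.polishSpace (f := Units.embedProduct (filteredEnd p lev))
    ⟨Units.isEmbedding_embedProduct, ?_⟩
  -- A unit is a pair of mutually inverse endomorphisms, which is a closed condition on pairs.
  have : range (Units.embedProduct (filteredEnd p lev)) =
      {q | q.1 * q.2.unop = 1 ∧ q.2.unop * q.1 = 1} := by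
    ext q
    constructor
    · rintro ⟨g, rfl⟩
      simp
    · rintro ⟨h1, h2⟩
      exact ⟨⟨q.1, q.2.unop, h1, h2⟩, rfl⟩
  rw [this]
  have hu : Continuous fun q : filteredEnd p lev × (filteredEnd p lev)ᵐᵒᵖ => q.2.unop :=
    MulOpposite.continuous_unop.comp continuous_snd
  exact (isClosed_eq (continuous_fst.mul hu) continuous_const).and
    (isClosed_eq (hu.mul continuous_fst) continuous_const)

/-- A filtered automorphism acts on functionals by precomposition with its inverse. -/
noncomputable instance : SMul (FilteredAut p lev) (I → ZMod p) where
  smul g x := fun k => pairing p x ((g⁻¹).1.1 (Finsupp.single k 1))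

theorem pairing_smul_left (g : FilteredAut p lev) (x : I → ZMod p) (v : I →₀ ZMod p) :
    pairing p (g • x) v = pairing p x ((g⁻¹).1.1 v) := by
  have : pairing p (g • x) = (pairing p x).comp (g⁻¹).1.1 := by
    refine Finsupp.lhom_ext' fun k => LinearMap.ext_ring ?_
    simp only [LinearMap.comp_apply, Finsupp.lsingle_apply, pairing_single, one_mul]
    rfl
  rw [this]
  rfl

theorem ext_pairing {x y : I → ZMod p} (h : ∀ v, pairing p x v = pairing p y v) : x = y := by
  ext k
  simpa using h (Finsupp.single k 1)

noncomputable instance : DistribMulAction (FilteredAut p lev) (I → ZMod p) where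
  one_smul x := ext_pairing fun v => by simp [pairing_smul_left]
  mul_smul g h x := ext_pairing fun v => by simp [pairing_smul_left]
  smul_zero g := ext_pairing fun v => by simp [pairing_smul_left]
  smul_add g x y := ext_pairing fun v => by simp [pairing_smul_left]

instance : SMulCommClass (FilteredAut p lev) (ZMod p) (I → ZMod p) where
  smul_comm g c x := ext_pairing fun v => by simp [pairing_smul_left]

theorem smul_mem_annih {β : Ordinal.{0}} (g : FilteredAut p lev) {x : I → ZMod p}
    (hx : x ∈ annih p lev β) : g • x ∈ annih p lev β := by
  rw [mem_annih_iff_pairing] at hx ⊢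
  intro v hv
  rw [pairing_smul_left]
  exact hx _ ((g⁻¹).1.2 β v hv)

theorem smul_mem_annih_iff {β : Ordinal.{0}} (g : FilteredAut p lev) {x : I → ZMod p} :
    g • x ∈ annih p lev β ↔ x ∈ annih p lev β :=
  ⟨fun h => by simpa using smul_mem_annih g⁻¹ h, smul_mem_annih g⟩

instance : ContinuousSMul (FilteredAut p lev) (I → ZMod p) where
  continuous_smul := by
    refine continuous_pi fun k => ?_
    -- The `k`-th coordinate of `g • x` depends on `g` only through the vector `g⁻¹ e_k` of a
    -- discrete space, so joint continuity reduces to continuity in `x`.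
    have h1 : Continuous fun q : (I →₀ ZMod p) × (I → ZMod p) => pairing p q.2 q.1 :=
      continuous_prod_of_discrete_left.2 continuous_pairing
    have h2 : Continuous fun g : FilteredAut p lev => (g⁻¹).1.1 (Finsupp.single k 1) :=
      (continuous_eval _).comp Units.continuous_coe_inv
    exact h1.comp ((h2.comp continuous_fst).prodMk continuous_snd)

instance : FaithfulSMul (FilteredAut p lev) (I → ZMod p) where
  eq_of_smul_eq_smul := by
    intro g h hgh
    rw [← inv_inj]
    ext1
    ext1
    refine LinearMap.ext fun v => pairing_injective fun x => ?_
    rw [← pairing_smul_left, ← pairing_smul_left, hgh]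

theorem isCompactGGroup [Countable I] [NeZero p] :
    PolishStr.IsCompactGGroup (FilteredAut p lev) (I → ZMod p) where
  isTopologicalGroup := inferInstance
  polishSpace := inferInstance
  faithful := inferInstance
  isClosed_stabilizer _ := isClosed_eq (continuous_id.smul continuous_const) continuous_const
  isTopologicalAddGroup := inferInstance
  compactSpace := inferInstance
  t2Space := inferInstance
  continuousSMul := inferInstance

theorem isEmptyClosed_annih (β : Ordinal.{0}) :
    PolishStr.IsEmptyClosed (FilteredAut p lev) (annih p lev β).toAddSubgroup := by
  refine ⟨isClosed_annih β, fun g => Subset.antisymm ?_ ?_⟩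
  · rintro _ ⟨x, hx, rfl⟩
    exact smul_mem_annih g hx
  · intro x hx
    exact ⟨g⁻¹ • x, smul_mem_annih g⁻¹ hx, by simp⟩

end Group

/-! ### Homogeneity: a back-and-forth argument -/

section Homogeneity

variable {I : Type} {p : ℕ} {lev : I → Ordinal.{0}} {ι : Type*}

/-- The least level of an index in the support of `v`. -/
noncomputable def order (lev : I → Ordinal.{0}) (v : I →₀ ZMod p) : WithTop Ordinal.{0} :=
  v.support.inf fun k => (lev k : WithTop Ordinal.{0})

theorem mem_levelGE_iff_le_order {β : Ordinal.{0}} {v : I →₀ ZMod p} :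
    v ∈ levelGE p lev β ↔ (β : WithTop Ordinal.{0}) ≤ order lev v := by
  rw [order, Finset.le_inf_iff, mem_levelGE]
  refine forall_congr' fun k => ?_
  rw [WithTop.coe_le_coe, Finsupp.mem_support_iff, ← not_lt, not_imp_not]

theorem exists_order_eq {v : I →₀ ZMod p} (hv : v ≠ 0) : ∃ k, order lev v = lev k := by
  obtain ⟨k, -, hk⟩ := Finset.exists_mem_eq_inf v.support (Finsupp.support_nonempty_iff.2 hv)
    fun k => (lev k : WithTop Ordinal.{0})
  exact ⟨k, hk⟩

/-- `P` is the graph of an isomorphism between subspaces that preserves the filtration and carries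
the functionals `a` to the functionals `a'`. -/
def IsPartialIso (lev : I → Ordinal.{0}) (a a' : ι → I → ZMod p)
    (P : Submodule (ZMod p) ((I →₀ ZMod p) × (I →₀ ZMod p))) : Prop :=
  ∀ q ∈ P, (∀ β, q.1 ∈ levelGE p lev β ↔ q.2 ∈ levelGE p lev β) ∧
    ∀ i, pairing p (a i) q.1 = pairing p (a' i) q.2

theorem IsPartialIso.swap {a a' : ι → I → ZMod p}
    {P : Submodule (ZMod p) ((I →₀ ZMod p) × (I →₀ ZMod p))} (hP : IsPartialIso lev a a' P) :
    IsPartialIso lev a' a (P.map (LinearEquiv.prodComm (ZMod p) _ _).toLinearMap) := by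
  rintro _ ⟨q, hq, rfl⟩
  exact ⟨fun β => ((hP q hq).1 β).symm, fun i => ((hP q hq).2 i).symm⟩

/-- Two tuples of functionals have the same type if corresponding linear combinations lie in the
same subspaces `annih p lev β`. -/
def SameType [Fintype ι] (lev : I → Ordinal.{0}) (a a' : ι → I → ZMod p) : Prop :=
  ∀ (c : ι → ZMod p) (β : Ordinal.{0}),
    ∑ i, c i • a i ∈ annih p lev β ↔ ∑ i, c i • a' i ∈ annih p lev β

theorem SameType.symm [Fintype ι] {a a' : ι → I → ZMod p} (h : SameType lev a a') :
    SameType lev a' a := fun c β => (h c β).symm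

variable [Fact p.Prime] [Fintype ι] {a a' : ι → I → ZMod p}

/-- The values of a tuple of functionals on a step of the filtration depend only on its type. -/
theorem SameType.exists_pairing_eq (h : SameType lev a a') {β : Ordinal.{0}} {v : I →₀ ZMod p}
    (hv : v ∈ levelGE p lev β) :
    ∃ w ∈ levelGE p lev β, ∀ i, pairing p (a' i) w = pairing p (a i) v := by
  classical
  let T : (I →₀ ZMod p) →ₗ[ZMod p] (ι → ZMod p) := LinearMap.pi fun i => pairing p (a' i)
  by_contra hcon
  have hnot : (fun i => pairing p (a i) v) ∉ (levelGE p lev β).map T := by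
    rintro ⟨w, hw, hwv⟩
    exact hcon ⟨w, hw, fun i => congrFun hwv i⟩
  -- A linear form `f` separates the values of `a` at `v` from all values of `a'` on `V_β`. Its
  -- coefficients give a combination of `a'` that annihilates `V_β`, while the same combination of
  -- `a` does not.
  obtain ⟨f, hf, hfT⟩ := Submodule.exists_le_ker_of_notMem hnot
  have hfsum : ∀ y : ι → ZMod p, f y = ∑ i, f (Pi.single i 1) * y i := by
    intro y
    conv_lhs => rw [LinearMap.pi_apply_eq_sum_univ f y]
    exact Finset.sum_congr rfl fun i _ => by
      rw [smul_eq_mul, mul_comm]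
      congr 2
      funext j
      simp [Pi.single_apply, eq_comm]
  have hpair : ∀ (b : ι → I → ZMod p) (u : I →₀ ZMod p),
      pairing p (∑ i, f (Pi.single i 1) • b i) u = f fun i => pairing p (b i) u := by
    intro b u
    rw [pairing_sum, hfsum]
    simp
  have ha' : ∑ i, f (Pi.single i 1) • a' i ∈ annih p lev β := by
    rw [mem_annih_iff_pairing]
    intro u hu
    rw [hpair]
    exact hfT ⟨u, hu, rfl⟩
  have ha := mem_annih_iff_pairing.1 ((h _ β).2 ha') v hv
  rw [hpair] at ha
  exact hf ha

/-- On an infinite set of indices of a given level one finds a common zero of finitely many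
functionals that avoids finitely many vectors modulo higher levels. -/
theorem exists_common_zero (a : ι → I → ZMod p) {β : Ordinal.{0}}
    (hβ : {k | lev k = β}.Infinite) {S : Set (I →₀ ZMod p)} (hS : S.Finite) :
    ∃ z ∈ levelGE p lev β, (∀ i, pairing p (a i) z = 0) ∧
      ∀ u ∈ S, z - u ∉ levelGE p lev (Order.succ β) := by
  classical
  have hU : (⋃ u ∈ S, (u.support : Set I)).Finite := hS.biUnion fun u _ => u.support.finite_toSet
  have hinf := hβ.sdiff hU
  -- Pigeonhole: infinitely many basis vectors outside the supports of `S`, finitely many value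
  -- vectors. The difference of two with equal values is the common zero.
  obtain ⟨j, hj, k, hk, hjk, hval⟩ := hinf.exists_ne_map_eq_of_mapsTo
    (f := fun k i => a i k) (t := (univ : Set (ι → ZMod p))) (fun _ _ => mem_univ _) finite_univ
  refine ⟨Finsupp.single j 1 - Finsupp.single k 1,
    Submodule.sub_mem _ (single_mem_levelGE 1 (ge_of_eq hj.1))
      (single_mem_levelGE 1 (ge_of_eq hk.1)), fun i => ?_, fun u hu hmem => ?_⟩
  · simpa [sub_eq_zero] using congrFun hval i
  · have h1 := hmem j (by rw [hj.1]; exact Order.lt_succ β)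
    have h2 : u j = 0 := by
      by_contra hne
      exact hj.2 (mem_biUnion hu (by simpa using hne))
    simp [h2, hjk.symm] at h1

/-- Correct `v` by an element of the domain to get `v₀` of the largest possible level `β`; then `v₀
- q.1 ∈ V_γ` forces `γ ≤ β`. Choose `w₀ ∈ V_β` with the required values and outside the range of `P`
modulo level `β + 1`. Then both `v₀ - q.1` and `w₀ - q.2` lie in `V_γ` iff `γ ≤ β` and `q` lies in
level `γ`, so sending `v₀` to `w₀` preserves the filtration. -/
theorem IsPartialIso.exists_extension {α : Ordinal.{0}} (hlt : ∀ k, lev k < α)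
    (hinf : ∀ β < α, {k | lev k = β}.Infinite) (h : SameType lev a a')
    {P : Submodule (ZMod p) ((I →₀ ZMod p) × (I →₀ ZMod p))} (hP : IsPartialIso lev a a' P)
    (hfin : (P : Set ((I →₀ ZMod p) × (I →₀ ZMod p))).Finite) (v : I →₀ ZMod p) :
    ∃ P', P ≤ P' ∧ IsPartialIso lev a a' P' ∧
      (P' : Set ((I →₀ ZMod p) × (I →₀ ZMod p))).Finite ∧ ∃ w, (v, w) ∈ P' := by
  classical
  by_cases hv : ∃ w, (v, w) ∈ P
  · exact ⟨P, le_rfl, hP, hfin, hv⟩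
  push Not at hv
  obtain ⟨q₀, hq₀, hmax⟩ := Set.exists_max_image _ (fun q => order lev (v - q.1)) hfin ⟨0, P.zero_mem⟩
  set v₀ := v - q₀.1 with hv₀
  have hv₀ne : v₀ ≠ 0 := by
    intro h0
    rw [hv₀, sub_eq_zero] at h0
    exact hv q₀.2 (by rw [h0]; exact hq₀)
  obtain ⟨k₀, hk₀⟩ := exists_order_eq (lev := lev) hv₀ne
  set β := lev k₀
  have hv₀mem : v₀ ∈ levelGE p lev β := mem_levelGE_iff_le_order.2 hk₀.ge
  have hmax' : ∀ q ∈ P, ∀ γ, v₀ - q.1 ∈ levelGE p lev γ → γ ≤ β := by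
    intro q hq γ hγ
    have h1 := hmax (q₀ + q) (P.add_mem hq₀ hq)
    rw [Prod.fst_add, ← sub_sub, ← hv₀, hk₀] at h1
    exact WithTop.coe_le_coe.1 ((mem_levelGE_iff_le_order.1 hγ).trans h1)
  obtain ⟨w₁, hw₁, hw₁a⟩ := h.exists_pairing_eq hv₀mem
  obtain ⟨z, hz, hza, hzS⟩ := exists_common_zero a' (hinf β (hlt k₀))
    (hfin.image fun q => q.2 - w₁)
  set w₀ := w₁ + z with hw₀
  have hw₀mem : w₀ ∈ levelGE p lev β := Submodule.add_mem _ hw₁ hz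
  have hw₀max : ∀ q ∈ P, ∀ γ, w₀ - q.2 ∈ levelGE p lev γ → γ ≤ β := by
    intro q hq γ hγ
    by_contra hcon
    refine hzS _ ⟨q, hq, rfl⟩ ?_
    have : z - (q.2 - w₁) = w₀ - q.2 := by rw [hw₀]; abel
    rw [this]
    exact levelGE_anti (Order.succ_le_of_lt (not_le.1 hcon)) hγ
  have hlevel : ∀ q ∈ P, ∀ γ, v₀ - q.1 ∈ levelGE p lev γ ↔ w₀ - q.2 ∈ levelGE p lev γ := by
    intro q hq γ
    constructor
    · intro hγ
      have hle := levelGE_anti (p := p) (lev := lev) (hmax' q hq γ hγ)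
      rw [Submodule.sub_mem_iff_right _ (hle hv₀mem)] at hγ
      rw [Submodule.sub_mem_iff_right _ (hle hw₀mem)]
      exact ((hP q hq).1 γ).1 hγ
    · intro hγ
      have hle := levelGE_anti (p := p) (lev := lev) (hw₀max q hq γ hγ)
      rw [Submodule.sub_mem_iff_right _ (hle hw₀mem)] at hγ
      rw [Submodule.sub_mem_iff_right _ (hle hv₀mem)]
      exact ((hP q hq).1 γ).2 hγ
  have hval : ∀ i, pairing p (a i) v₀ = pairing p (a' i) w₀ := by
    intro i
    rw [hw₀, map_add, hza, hw₁a, add_zero]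
  refine ⟨P ⊔ Submodule.span (ZMod p) {(v₀, w₀)}, le_sup_left, ?_, ?_, q₀.2 + w₀, ?_⟩
  · intro q hq
    obtain ⟨r, hr, s, hs, rfl⟩ := Submodule.mem_sup.1 hq
    obtain ⟨t, rfl⟩ := Submodule.mem_span_singleton.1 hs
    refine ⟨fun γ => ?_, fun i => ?_⟩
    · rcases eq_or_ne t 0 with rfl | ht
      · simpa using (hP r hr).1 γ
      · have e : ∀ x y : I →₀ ZMod p, x + t • y = t • (y - (-t⁻¹) • x) := by
          intro x y
          rw [smul_sub, smul_smul, mul_neg, mul_inv_cancel₀ ht]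
          module
        have := hlevel ((-t⁻¹) • r) (P.smul_mem _ hr) γ
        simp only [Prod.fst_add, Prod.snd_add, Prod.smul_fst, Prod.smul_snd] at this ⊢
        rwa [e, e, Submodule.smul_mem_iff _ ht, Submodule.smul_mem_iff _ ht]
    · simp [(hP r hr).2 i, hval i]
  · refine ((hfin.prod (finite_univ (α := ZMod p))).image fun q => q.1 + q.2 • (v₀, w₀)).subset ?_
    intro q hq
    obtain ⟨r, hr, s, hs, rfl⟩ := Submodule.mem_sup.1 hq
    obtain ⟨t, rfl⟩ := Submodule.mem_span_singleton.1 hs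
    exact ⟨(r, t), ⟨hr, mem_univ _⟩, rfl⟩
  · refine Submodule.mem_sup.2 ⟨q₀, hq₀, _, Submodule.mem_span_singleton_self _, ?_⟩
    ext1
    · simp [hv₀]
    · simp

/-- Among finite partial isomorphisms, having a given vector in the domain or in the range is a
cofinal demand; the range case is the domain case with sides swapped. An ideal meeting these
countably many demands has the desired graph as its union. -/
theorem SameType.exists_total_iso [Countable I] {α : Ordinal.{0}} (hlt : ∀ k, lev k < α)
    (hinf : ∀ β < α, {k | lev k = β}.Infinite) (h : SameType lev a a') :
    ∃ P, IsPartialIso lev a a' P ∧ (∀ v, ∃ w, (v, w) ∈ P) ∧ ∀ w, ∃ v, (v, w) ∈ P := by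
  classical
  let Q := {P : Submodule (ZMod p) ((I →₀ ZMod p) × (I →₀ ZMod p)) //
    IsPartialIso lev a a' P ∧ (P : Set ((I →₀ ZMod p) × (I →₀ ZMod p))).Finite}
  let left : (I →₀ ZMod p) → Order.Cofinal Q := fun v =>
    { carrier := {P | ∃ w, (v, w) ∈ P.1}
      isCofinal := by
        rintro ⟨P, hP, hfin⟩
        obtain ⟨P', h1, h2, h3, h4⟩ := hP.exists_extension hlt hinf h hfin v
        exact ⟨⟨P', h2, h3⟩, h4, h1⟩ }
  let right : (I →₀ ZMod p) → Order.Cofinal Q := fun w =>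
    { carrier := {P | ∃ v, (v, w) ∈ P.1}
      isCofinal := by
        rintro ⟨P, hP, hfin⟩
        obtain ⟨P', h1, h2, h3, v, h4⟩ := hP.swap.exists_extension hlt hinf h.symm
          (hfin.image _) w
        refine ⟨⟨P'.map (LinearEquiv.prodComm (ZMod p) _ _).toLinearMap, h2.swap, h3.image _⟩,
          ⟨v, ⟨(w, v), h4, rfl⟩⟩, ?_⟩
        intro q hq
        exact ⟨q.swap, h1 ⟨q, hq, rfl⟩, by simp⟩ }
  have hbot : IsPartialIso lev a a' ⊥ := by
    intro q hq
    rw [Submodule.mem_bot] at hq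
    subst hq
    simp
  let _ : Encodable ((I →₀ ZMod p) ⊕ (I →₀ ZMod p)) := Encodable.ofCountable _
  let J : Order.Ideal Q := Order.idealOfCofinals ⟨⊥, hbot, by simp⟩ (Sum.elim left right)
  have hmeet := Order.cofinal_meets_idealOfCofinals
    (⟨⊥, hbot, by simp⟩ : Q) (Sum.elim left right)
  have hne : (Subtype.val '' (J : Set Q)).Nonempty := J.nonempty.image _
  have hdir : DirectedOn (· ≤ ·) (Subtype.val '' (J : Set Q)) := by
    rintro _ ⟨P, hP, rfl⟩ _ ⟨P', hP', rfl⟩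
    obtain ⟨R, hR, h1, h2⟩ := J.directed P hP P' hP'
    exact ⟨R.1, ⟨R, hR, rfl⟩, h1, h2⟩
  refine ⟨sSup (Subtype.val '' (J : Set Q)), ?_, ?_, ?_⟩
  · intro q hq
    obtain ⟨_, ⟨P, -, rfl⟩, hqP⟩ := (Submodule.mem_sSup_of_directed hne hdir).1 hq
    exact P.2.1 q hqP
  · intro v
    obtain ⟨P, ⟨w, hw⟩, hPJ⟩ := hmeet (Sum.inl v)
    exact ⟨w, (Submodule.mem_sSup_of_directed hne hdir).2 ⟨P.1, mem_image_of_mem _ hPJ, hw⟩⟩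
  · intro w
    obtain ⟨P, ⟨v, hv⟩, hPJ⟩ := hmeet (Sum.inr w)
    exact ⟨v, (Submodule.mem_sSup_of_directed hne hdir).2 ⟨P.1, mem_image_of_mem _ hPJ, hv⟩⟩

/-- Tuples of functionals of the same type are conjugate under the filtered automorphisms. -/
theorem SameType.exists_smul_eq [Countable I] {α : Ordinal.{0}} (hlt : ∀ k, lev k < α)
    (hinf : ∀ β < α, {k | lev k = β}.Infinite) (h : SameType lev a a') :
    ∃ g : FilteredAut p lev, ∀ i, g • a i = a' i := by
  obtain ⟨P, hP, hl, hr⟩ := h.exists_total_iso hlt hinf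
  -- All levels lie below `α`, so `V_α = 0`, and preservation of membership in `V_α` makes the
  -- relation injective in both directions.
  have hzero : ∀ v ∈ levelGE p lev α, v = 0 := fun v hv => Finsupp.ext fun k => hv k (hlt k)
  have hfst : Function.Bijective ((LinearMap.fst (ZMod p) _ _).comp P.subtype) := by
    refine ⟨(injective_iff_map_eq_zero _).2 ?_, fun v => ?_⟩
    · rintro ⟨q, hq⟩ (h0 : q.1 = 0)
      have := hzero _ (((hP q hq).1 α).1 (h0 ▸ Submodule.zero_mem _))
      exact Subtype.ext (Prod.ext h0 this)
    · obtain ⟨w, hw⟩ := hl v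
      exact ⟨⟨_, hw⟩, rfl⟩
  have hsnd : Function.Bijective ((LinearMap.snd (ZMod p) _ _).comp P.subtype) := by
    refine ⟨(injective_iff_map_eq_zero _).2 ?_, fun w => ?_⟩
    · rintro ⟨q, hq⟩ (h0 : q.2 = 0)
      have := hzero _ (((hP q hq).1 α).2 (h0 ▸ Submodule.zero_mem _))
      exact Subtype.ext (Prod.ext this h0)
    · obtain ⟨v, hv⟩ := hr w
      exact ⟨⟨_, hv⟩, rfl⟩
  let e : (I →₀ ZMod p) ≃ₗ[ZMod p] (I →₀ ZMod p) :=
    (LinearEquiv.ofBijective _ hfst).symm.trans (LinearEquiv.ofBijective _ hsnd)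
  have he : ∀ v, (v, e v) ∈ P := by
    intro v
    obtain ⟨q, rfl⟩ := (LinearEquiv.ofBijective _ hfst).surjective v
    have : e (LinearEquiv.ofBijective _ hfst q) = q.1.2 := by
      simp only [e, LinearEquiv.trans_apply, LinearEquiv.symm_apply_apply]
      rfl
    rw [this]
    exact q.2
  have he' : ∀ v, (e.symm v, v) ∈ P := fun v => by simpa using he (e.symm v)
  let g : FilteredAut p lev :=
    { val := ⟨e.toLinearMap, fun β v hv => ((hP _ (he v)).1 β).1 hv⟩
      inv := ⟨e.symm.toLinearMap, fun β v hv => ((hP _ (he' v)).1 β).2 hv⟩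
      val_inv := Subtype.ext (LinearMap.ext fun v => e.apply_symm_apply v)
      inv_val := Subtype.ext (LinearMap.ext fun v => e.symm_apply_apply v) }
  refine ⟨g, fun i => ext_pairing fun v => ?_⟩
  rw [pairing_smul_left]
  exact (hP _ (he' v)).2 i

end Homogeneity

open PolishStr

/-! ### The rank of a functional over a finite set -/

section Rank

variable {I : Type} {p : ℕ} {lev : I → Ordinal.{0}} {α : Ordinal.{0}}

/-- The least `β` such that `a` agrees with an element of the span of `A` modulo
`annih p lev β`. -/
noncomputable def depRank (lev : I → Ordinal.{0}) (a : I → ZMod p) (A : Set (I → ZMod p)) :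
    Ordinal.{0} :=
  sInf {β | ∃ c ∈ Submodule.span (ZMod p) A, a - c ∈ annih p lev β}

theorem mem_annih_top (hlt : ∀ k, lev k < α) (x : I → ZMod p) : x ∈ annih p lev α :=
  fun k hk => absurd (hlt k) (not_lt.2 hk)

/-- The infimum is attained: `α` with `c = 0` is a candidate, so the default value of `sInf ∅` never
enters. -/
theorem exists_sub_mem_annih (hlt : ∀ k, lev k < α) (a : I → ZMod p) (A : Set (I → ZMod p)) :
    ∃ c ∈ Submodule.span (ZMod p) A, a - c ∈ annih p lev (depRank lev a A) :=
  csInf_mem (s := {β | ∃ c ∈ Submodule.span (ZMod p) A, a - c ∈ annih p lev β})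
    ⟨α, 0, Submodule.zero_mem _, mem_annih_top hlt _⟩

theorem depRank_le {a c : I → ZMod p} {A : Set (I → ZMod p)} {β : Ordinal.{0}}
    (hc : c ∈ Submodule.span (ZMod p) A) (h : a - c ∈ annih p lev β) : depRank lev a A ≤ β :=
  csInf_le' ⟨c, hc, h⟩

theorem depRank_le_top (hlt : ∀ k, lev k < α) (a : I → ZMod p) (A : Set (I → ZMod p)) :
    depRank lev a A ≤ α :=
  depRank_le (Submodule.zero_mem _) (mem_annih_top hlt _)

theorem depRank_anti (hlt : ∀ k, lev k < α) (a : I → ZMod p) {A B : Set (I → ZMod p)}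
    (h : A ⊆ B) : depRank lev a B ≤ depRank lev a A := by
  obtain ⟨c, hc, hac⟩ := exists_sub_mem_annih hlt a A
  exact depRank_le (Submodule.span_mono h hc) hac

theorem countable_Iio_of_infinite_fibers [Countable I]
    (hinf : ∀ β < α, {k | lev k = β}.Infinite) : (Iio α).Countable := by
  refine (countable_range lev).mono fun β hβ => ?_
  obtain ⟨k, hk⟩ := (hinf β hβ).nonempty
  exact ⟨k, hk⟩

theorem countable_Iic_of_infinite_fibers [Countable I]
    (hinf : ∀ β < α, {k | lev k = β}.Infinite) : (Iic α).Countable := by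
  rw [← Iio_insert]
  exact (countable_Iio_of_infinite_fibers hinf).insert α

theorem smul_eq_of_mem_span {A : Set (I → ZMod p)} {g : FilteredAut p lev}
    (hg : g ∈ fixingSubgroup (FilteredAut p lev) A) {c : I → ZMod p}
    (hc : c ∈ Submodule.span (ZMod p) A) : g • c = c := by
  induction hc using Submodule.span_induction with
  | mem x hx => exact (mem_fixingSubgroup_iff _).1 hg x hx
  | zero => exact smul_zero g
  | add x y _ _ hx hy => rw [smul_add, hx, hy]
  | smul t x _ hx => rw [smul_comm, hx]

theorem smul_sub_mem_annih_iff {A : Set (I → ZMod p)} {g : FilteredAut p lev}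
    (hg : g ∈ fixingSubgroup (FilteredAut p lev) A) {a c : I → ZMod p}
    (hc : c ∈ Submodule.span (ZMod p) A) {β : Ordinal.{0}} :
    g • a - c ∈ annih p lev β ↔ a - c ∈ annih p lev β := by
  conv_lhs => rw [← smul_eq_of_mem_span hg hc, ← smul_sub, smul_mem_annih_iff]

theorem depRank_smul {A : Set (I → ZMod p)} {g : FilteredAut p lev}
    (hg : g ∈ fixingSubgroup (FilteredAut p lev) A) (a : I → ZMod p) :
    depRank lev (g • a) A = depRank lev a A := by
  unfold depRank
  congr 1
  ext β
  exact exists_congr fun c => and_congr_right fun hc => smul_sub_mem_annih_iff hg hc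

variable [Fact p.Prime]

/-- Below the rank of `a` over `A`, some vector is annihilated by `A` but not by `a`. -/
theorem exists_pairing_ne_zero {a : I → ZMod p} {A : Set (I → ZMod p)} (hA : A.Finite)
    {β : Ordinal.{0}} (hβ : β < depRank lev a A) :
    ∃ w ∈ levelGE p lev β, (∀ x ∈ A, pairing p x w = 0) ∧ pairing p a w ≠ 0 := by
  by_contra! hcon
  have : Finite A := hA
  have := Fintype.ofFinite A
  let L : A → levelGE p lev β →ₗ[ZMod p] ZMod p := fun x => (pairing p x.1).comp (Submodule.subtype _)
  have hker : ⨅ x, LinearMap.ker (L x) ≤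
      LinearMap.ker ((pairing p a).comp (levelGE p lev β).subtype) := by
    rintro ⟨w, hw⟩ hwL
    exact hcon w hw fun x hx => (Submodule.mem_iInf _).1 hwL ⟨x, hx⟩
  -- If `a` vanishes on the common kernel of `A` in `V_β`, then on `V_β` it is a combination of
  -- finitely many forms from `A`, contradicting `β < depRank lev a A`.
  obtain ⟨c, hc⟩ := (Submodule.mem_span_range_iff_exists_fun _).1 (mem_span_of_iInf_ker_le_ker hker)
  refine absurd (depRank_le (c := ∑ x, c x • x.1)
    (Submodule.sum_mem _ fun x _ => Submodule.smul_mem _ _ (Submodule.subset_span x.2)) ?_)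
    (not_le.2 hβ)
  rw [mem_annih_iff_pairing]
  intro v hv
  have := LinearMap.congr_fun hc ⟨v, hv⟩
  simp only [LinearMap.sum_apply, LinearMap.smul_apply, L, LinearMap.comp_apply,
    Submodule.subtype_apply, smul_eq_mul] at this
  rw [pairing_sub, pairing_sum, ← this]
  simp

/-- The transvection `v ↦ v + v k • w`, for `w` with `w k = 0` of level at least that of `k`. -/
noncomputable def transvectionEnd (k : I) (w : I →₀ ZMod p) (hw : w ∈ levelGE p lev (lev k)) :
    filteredEnd p lev where
  val := LinearMap.id + (Finsupp.lapply k).smulRight w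
  property := by
    intro β v hv
    refine Submodule.add_mem _ hv ?_
    rcases lt_or_ge (lev k) β with h | h
    · have : v k = 0 := hv k h
      simp [this]
    · exact Submodule.smul_mem _ _ (levelGE_anti h hw)

theorem transvectionEnd_apply (k : I) (w : I →₀ ZMod p) (hw : w ∈ levelGE p lev (lev k))
    (v : I →₀ ZMod p) : (transvectionEnd k w hw).1 v = v + v k • w := rfl

/-- The automorphism acting on functionals by precomposition with `v ↦ v + v k • w`. -/
noncomputable def transvection (k : I) (w : I →₀ ZMod p) (hw : w ∈ levelGE p lev (lev k))
    (hk : w k = 0) : FilteredAut p lev where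
  val := transvectionEnd k (-w) (Submodule.neg_mem _ hw)
  inv := transvectionEnd k w hw
  val_inv := by
    ext1
    refine LinearMap.ext fun v => ?_
    change (transvectionEnd k (-w) (Submodule.neg_mem _ hw)).1 ((transvectionEnd k w hw).1 v) = v
    simp [transvectionEnd_apply, hk]
  inv_val := by
    ext1
    refine LinearMap.ext fun v => ?_
    change (transvectionEnd k w hw).1 ((transvectionEnd k (-w) (Submodule.neg_mem _ hw)).1 v) = v
    simp [transvectionEnd_apply, hk]

theorem pairing_transvection_smul {k : I} {w : I →₀ ZMod p} (hw : w ∈ levelGE p lev (lev k))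
    (hk : w k = 0) (x : I → ZMod p) (v : I →₀ ZMod p) :
    pairing p (transvection k w hw hk • x) v = pairing p x v + v k * pairing p x w := by
  rw [pairing_smul_left]
  change pairing p x (v + v k • w) = _
  simp

/-- Elements of `G_A` move `a` out of a translate of `annih p lev β`, for `β` below the rank of `a`
over `A`, on a dense open set. -/
theorem isNowhereDense_smul_sub_mem (hlt : ∀ k, lev k < α)
    (hinf : ∀ β < α, {k | lev k = β}.Infinite) {a : I → ZMod p} {A : Set (I → ZMod p)}
    (hA : A.Finite) {β : Ordinal.{0}} (hβ : β < depRank lev a A) (d : I → ZMod p) :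
    IsNowhereDense {g : fixingSubgroup (FilteredAut p lev) A |
      (g : FilteredAut p lev) • a - d ∈ annih p lev β} := by
  classical
  have hcl : IsClosed {g : fixingSubgroup (FilteredAut p lev) A |
      (g : FilteredAut p lev) • a - d ∈ annih p lev β} :=
    (isClosed_annih β).preimage
      ((continuous_subtype_val.smul continuous_const).sub continuous_const)
  rw [hcl.isNowhereDense_iff, Set.eq_empty_iff_forall_notMem]
  intro g₀ hg₀
  set b := (g₀ : FilteredAut p lev) • a with hb
  rw [← depRank_smul g₀.2, ← hb] at hβ
  obtain ⟨w, hw, hwA, hwb⟩ := exists_pairing_ne_zero hA hβ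
  have hlev := (hinf β (hβ.trans_le (depRank_le_top hlt _ _))).sdiff w.support.finite_toSet
  -- Transvections along `w` at distinct indices of level `β` outside the support of `w`. They tend
  -- to `1`, since a given vector vanishes at almost all of these indices, and they fix `A`, since
  -- `A` annihilates `w`.
  let k : ℕ → I := fun n => hlev.natEmbedding _ n
  have hk : ∀ n, lev (k n) = β ∧ w (k n) = 0 := by
    intro n
    have := (hlev.natEmbedding _ n).2
    exact ⟨this.1, by simpa using this.2⟩
  have hkinj : Function.Injective k :=
    Subtype.val_injective.comp (hlev.natEmbedding _).injective
  have hkw : ∀ n, w ∈ levelGE p lev (lev (k n)) := fun n => by rw [(hk n).1]; exact hw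
  let t : ℕ → FilteredAut p lev := fun n => transvection (k n) w (hkw n) (hk n).2
  have hkv : ∀ v : I →₀ ZMod p, ∀ᶠ n in atTop, v (k n) = 0 := by
    intro v
    have : {n | v (k n) ≠ 0}.Finite := by
      refine (v.support.finite_toSet.preimage hkinj.injOn).subset fun n hn => ?_
      simpa using hn
    rw [← Nat.cofinite_eq_atTop]
    simpa [Filter.eventually_cofinite] using this
  -- Both signs are needed: convergence in the unit group means convergence of the elements and of
  -- their inverses.
  have htend : ∀ u : ℕ → filteredEnd p lev,
      (∀ n, (u n).1 = (LinearMap.id + (Finsupp.lapply (k n)).smulRight w) ∨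
        (u n).1 = (LinearMap.id + (Finsupp.lapply (k n)).smulRight (-w))) →
      Tendsto u atTop (𝓝 1) := by
    intro u hu
    rw [(isEmbedding_evalFun p lev).tendsto_nhds_iff, tendsto_pi_nhds]
    intro v
    refine tendsto_nhds_of_eventually_eq ?_
    filter_upwards [hkv v] with n hn
    rcases hu n with h | h <;> simp [evalFun, h, hn]
  have ht1 : Tendsto t atTop (𝓝 1) := by
    rw [Units.isEmbedding_embedProduct.tendsto_nhds_iff, map_one]
    refine Tendsto.prodMk_nhds (htend _ fun n => Or.inr rfl) ?_
    exact (MulOpposite.continuous_op.tendsto (1 : filteredEnd p lev)).comp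
      (htend (fun n => (t n)⁻¹.1) fun n => Or.inl rfl)
  have htA : ∀ n, t n ∈ fixingSubgroup (FilteredAut p lev) A := by
    intro n
    rw [mem_fixingSubgroup_iff]
    intro x hx
    refine ext_pairing fun v => ?_
    rw [pairing_transvection_smul, hwA x hx, mul_zero, add_zero]
  have hlim : Tendsto (fun n => (⟨t n, htA n⟩ : fixingSubgroup (FilteredAut p lev) A) * g₀) atTop
      (𝓝 g₀) := by
    have : Tendsto (fun n => (⟨t n, htA n⟩ : fixingSubgroup (FilteredAut p lev) A)) atTop
        (𝓝 1) := tendsto_subtype_rng.2 ht1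
    simpa using this.mul_const g₀
  have hev := hlim.eventually (isOpen_interior.mem_nhds hg₀)
  obtain ⟨n, hn⟩ := hev.exists
  have h1 : t n • b - d ∈ annih p lev β := by
    have := interior_subset hn
    simpa [mul_smul] using this
  have h2 := interior_subset hg₀
  rw [mem_ofPred_eq, ← hb] at h2
  have h3 := Submodule.sub_mem _ h1 h2
  rw [sub_sub_sub_cancel_right, mem_annih_iff_pairing] at h3
  -- At the basis vector `e_{k n}` the difference `t n • b - b` takes the value `b(w) ≠ 0`, although
  -- `annih p lev β` kills that vector.
  have h4 := h3 _ (single_mem_levelGE 1 (hk n).1.ge)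
  rw [pairing_sub, pairing_transvection_smul] at h4
  simp [hwb] at h4

/-- There are functionals of rank `γ` over a finite set, for every `γ ≤ α`. -/
theorem exists_generic (hinf : ∀ β < α, {k | lev k = β}.Infinite) {A : Set (I → ZMod p)}
    (hA : A.Finite) {γ : Ordinal.{0}} (hγ : γ ≤ α) :
    ∃ x ∈ annih p lev γ, ∀ β < γ, ∀ c ∈ Submodule.span (ZMod p) A, x - c ∉ annih p lev β := by
  classical
  have := FiniteDimensional.span_of_finite (ZMod p) hA
  have : Finite (Submodule.span (ZMod p) A) := Module.finite_of_finite (ZMod p)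
  have hex : ∀ β : Iio γ, ∃ f : I → ZMod p,
      ∀ c ∈ Submodule.span (ZMod p) A, ∃ k, lev k = β ∧ f k ≠ c k := by
    rintro ⟨β, hβ⟩
    have hβ' := hinf β (lt_of_lt_of_le hβ hγ)
    let e := hβ'.natEmbedding
    obtain ⟨N, ⟨s⟩⟩ := Finite.exists_equiv_fin (Submodule.span (ZMod p) A)
    -- Diagonalization: enumerate the finite span and make `f` differ from its `n`-th element at the
    -- `n`-th index of level `β`.
    let f : I → ZMod p := Function.extend (fun n : Fin N => (e n : I))
      (fun n => (s.symm n).1 (e n) + 1) 0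
    refine ⟨f, fun c hc => ⟨e (s ⟨c, hc⟩), (e _).2, ?_⟩⟩
    have hinj : Function.Injective fun n : Fin N => (e n : I) :=
      Subtype.val_injective.comp (e.injective.comp Fin.val_injective)
    have : f (e (s ⟨c, hc⟩)) = c (e (s ⟨c, hc⟩)) + 1 := by
      have := hinj.extend_apply (fun n => (s.symm n).1 (e n) + 1) 0 (s ⟨c, hc⟩)
      simpa using this
    rw [this]
    simp
  choose f hf using hex
  refine ⟨fun k => if h : lev k < γ then f ⟨lev k, h⟩ k else 0, fun k hk => ?_, ?_⟩
  · exact dif_neg (not_lt.2 hk)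
  · intro β hβ c hc hmem
    obtain ⟨k, hk, hne⟩ := hf ⟨β, hβ⟩ c hc
    have := hmem k hk.ge
    simp only at hk
    subst hk
    rw [Pi.sub_apply, dif_pos hβ, sub_eq_zero] at this
    exact hne this

/-- Over a larger finite set the rank of `a` can take any smaller value. -/
theorem exists_depRank_insert_eq (hlt : ∀ k, lev k < α)
    (hinf : ∀ β < α, {k | lev k = β}.Infinite) {a : I → ZMod p} {A : Set (I → ZMod p)}
    (hA : A.Finite) {γ : Ordinal.{0}} (hγ : γ < depRank lev a A) :
    ∃ b, depRank lev a (insert b A) = γ := by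
  obtain ⟨x, hx, hxA⟩ := exists_generic hinf hA (hγ.le.trans (depRank_le_top hlt a A))
  -- The upper bound is `a - (a + x) = -x ∈ H_γ`. For the lower bound consider `d = t(a + x) + c`:
  -- if `t = 1`, closeness of `a` to `d` contradicts genericity of `x`; if `t ≠ 1`, dividing by `1 -
  -- t` gives `a` rank at most `γ` over `A`.
  refine ⟨a + x, le_antisymm ?_ (le_of_not_gt fun hlt' => ?_)⟩
  · refine depRank_le (c := a + x) (Submodule.subset_span (mem_insert _ _)) ?_
    rw [sub_add_cancel_left]
    exact Submodule.neg_mem _ hx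
  · obtain ⟨d, hd, had⟩ := exists_sub_mem_annih hlt a (insert (a + x) A)
    set β := depRank lev a (insert (a + x) A)
    obtain ⟨t, c, hc, rfl⟩ := Submodule.mem_span_insert.1 hd
    rcases eq_or_ne t 1 with rfl | ht
    · refine hxA β hlt' (-c) (Submodule.neg_mem _ hc) ?_
      have : x - -c = -(a - ((1 : ZMod p) • (a + x) + c)) := by module
      rw [this]
      exact Submodule.neg_mem _ had
    · have ht' : 1 - t ≠ 0 := sub_ne_zero.2 ht.symm
      refine absurd (depRank_le (Submodule.smul_mem _ (1 - t)⁻¹ hc) ?_) (not_le.2 hγ)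
      have : (1 - t) • (a - (1 - t)⁻¹ • c) = (a - (t • (a + x) + c)) + t • x := by
        rw [smul_sub, smul_smul, mul_inv_cancel₀ ht']
        module
      rw [← Submodule.smul_mem_iff _ ht', this]
      exact Submodule.add_mem _ (annih_mono hlt'.le had) (Submodule.smul_mem _ _ hx)

/-- Adding a basis functional of level `β` leaves `H_β` but stays in `H_γ`. Such functionals at
distinct indices tend to `0`, so no point of `H_β` is interior. -/
theorem nwdSubgroup_annih (hinf : ∀ β < α, {k | lev k = β}.Infinite) {β γ : Ordinal.{0}}
    (hβγ : β < γ) (hγ : γ ≤ α) :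
    NwdSubgroup (annih p lev β).toAddSubgroup (annih p lev γ).toAddSubgroup := by
  classical
  refine ⟨annih_mono hβγ.le, ?_⟩
  have hcl : IsClosed {x : (annih p lev γ).toAddSubgroup |
      (x : I → ZMod p) ∈ (annih p lev β).toAddSubgroup} :=
    (isClosed_annih β).preimage continuous_subtype_val
  rw [hcl.isNowhereDense_iff, Set.eq_empty_iff_forall_notMem]
  intro x hx
  have hlev := hinf β (hβγ.trans_le hγ)
  let k : ℕ → I := fun n => hlev.natEmbedding _ n
  have hk : ∀ n, lev (k n) = β := fun n => (hlev.natEmbedding _ n).2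
  have hkinj : Function.Injective k :=
    Subtype.val_injective.comp (hlev.natEmbedding _).injective
  have hmem : ∀ n, (x : I → ZMod p) + Pi.single (k n) 1 ∈ annih p lev γ := by
    intro n
    refine Submodule.add_mem _ x.2 fun j hj => Pi.single_eq_of_ne ?_ _
    rintro rfl
    rw [hk] at hj
    exact absurd hβγ (not_lt.2 hj)
  have hlim : Tendsto (fun n => (⟨_, hmem n⟩ : (annih p lev γ).toAddSubgroup)) atTop (𝓝 x) := by
    rw [tendsto_subtype_rng, tendsto_pi_nhds]
    intro j
    refine tendsto_nhds_of_eventually_eq ?_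
    have : {n | k n = j}.Finite := (finite_singleton j).preimage hkinj.injOn
    rw [← Nat.cofinite_eq_atTop]
    filter_upwards [this.compl_mem_cofinite] with n hn
    have hne : j ≠ k n := fun h => hn h.symm
    simp [hne]
  obtain ⟨n, hn⟩ := (hlim.eventually (isOpen_interior.mem_nhds hx)).exists
  have h1 := interior_subset hn
  have h2 := interior_subset hx
  rw [mem_ofPred_eq, Submodule.mem_toAddSubgroup] at h1 h2
  have h3 := (Submodule.add_mem_iff_right _ h2).1 h1 (k n) (hk n).ge
  simp at h3

variable [Countable I]

instance (A : Set (I → ZMod p)) : BaireSpace (fixingSubgroup (FilteredAut p lev) A) := by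
  have hcl : IsClosed (fixingSubgroup (FilteredAut p lev) A : Set (FilteredAut p lev)) := by
    have : (fixingSubgroup (FilteredAut p lev) A : Set (FilteredAut p lev)) =
        ⋂ x ∈ A, {g | g • x = x} := by
      ext g
      simp [mem_fixingSubgroup_iff]
    rw [this]
    exact isClosed_biInter fun x _ =>
      isClosed_eq (continuous_id.smul continuous_const) continuous_const
  have : PolishSpace (fixingSubgroup (FilteredAut p lev) A) := hcl.polishSpace
  infer_instance

/-- Elements with the same differences modulo the filtration are conjugate over `C`. -/
theorem mem_orbitOver_of_sub_mem_iff (hlt : ∀ k, lev k < α)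
    (hinf : ∀ β < α, {k | lev k = β}.Infinite) {a b : I → ZMod p} {C : Set (I → ZMod p)}
    (hC : C.Finite)
    (h : ∀ c ∈ Submodule.span (ZMod p) C, ∀ β, a - c ∈ annih p lev β ↔ b - c ∈ annih p lev β) :
    b ∈ orbitOver (FilteredAut p lev) a C := by
  classical
  have : Finite C := hC
  have := Fintype.ofFinite C
  -- The tuples `(a, C)` and `(b, C)` are compared; when `a` has a nonzero coefficient, scaling
  -- reduces to the hypothesis.
  have hST : SameType lev (fun o : Option C => o.elim a Subtype.val)
      (fun o : Option C => o.elim b Subtype.val) := by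
    intro c β
    simp only [Fintype.sum_option, Option.elim_none, Option.elim_some]
    set s := ∑ x : C, c (some x) • x.1 with hs
    have hsC : s ∈ Submodule.span (ZMod p) C :=
      Submodule.sum_mem _ fun x _ => Submodule.smul_mem _ _ (Submodule.subset_span x.2)
    generalize c none = t
    rcases eq_or_ne t 0 with rfl | ht
    · simp
    · have e : ∀ x : I → ZMod p, t • x + s = t • (x - (-t⁻¹) • s) := by
        intro x
        rw [smul_sub, smul_smul, mul_neg, mul_inv_cancel₀ ht]
        module
      rw [e, e, Submodule.smul_mem_iff _ ht, Submodule.smul_mem_iff _ ht]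
      exact h _ (Submodule.smul_mem _ _ hsC) β
  obtain ⟨g, hg⟩ := hST.exists_smul_eq hlt hinf
  refine ⟨g, ?_, hg none⟩
  rw [mem_fixingSubgroup_iff]
  exact fun x hx => hg (some ⟨x, hx⟩)

/-- If the rank drops to `β`, every relevant `g` keeps `a` in one fixed coset of `H_β`, a nowhere
dense condition. If it does not, generic `g` takes `a` out of the countably many cosets `d + H_β`
with `β` below the rank. At higher `β`, `a` and `g • a` are congruent to the same element of `span
A`, so `g • a` is conjugate to `a` over `A ∪ B`. -/
theorem nmIndep_iff (hlt : ∀ k, lev k < α)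
    (hinf : ∀ β < α, {k | lev k = β}.Infinite) {a : I → ZMod p} {A B : Set (I → ZMod p)}
    (hA : A.Finite) (hB : B.Finite) :
    NMIndep (FilteredAut p lev) a A B ↔ depRank lev a (A ∪ B) = depRank lev a A := by
  have hle : depRank lev a (A ∪ B) ≤ depRank lev a A := depRank_anti hlt a subset_union_left
  constructor
  · intro hind
    by_contra hne
    refine hind ?_
    obtain ⟨c, hc, hac⟩ := exists_sub_mem_annih hlt a (A ∪ B)
    refine (isNowhereDense_smul_sub_mem hlt hinf hA (lt_of_le_of_ne hle hne) c).isMeagre.mono ?_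
    rintro g ⟨h, hh, hha⟩
    rw [mem_ofPred_eq, ← hha]
    exact (smul_sub_mem_annih_iff hh hc).2 hac
  · intro heq hmea
    have hcount : (Iio (depRank lev a A)).Countable :=
      (countable_Iio_of_infinite_fibers hinf).mono (Iio_subset_Iio (depRank_le_top hlt a A))
    have hspan : (Submodule.span (ZMod p) (A ∪ B) : Set (I → ZMod p)).Countable := by
      have := FiniteDimensional.span_of_finite (ZMod p) (hA.union hB)
      have : Finite (Submodule.span (ZMod p) (A ∪ B)) := Module.finite_of_finite (ZMod p)
      exact Set.to_countable _
    have hbad : IsMeagre (⋃ β ∈ Iio (depRank lev a A),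
        ⋃ d ∈ (Submodule.span (ZMod p) (A ∪ B) : Set (I → ZMod p)),
          {g : fixingSubgroup (FilteredAut p lev) A |
            (g : FilteredAut p lev) • a - d ∈ annih p lev β}) :=
      isMeagre_biUnion hcount fun β hβ => isMeagre_biUnion hspan fun d _ =>
        (isNowhereDense_smul_sub_mem hlt hinf hA hβ d).isMeagre
    refine not_isMeagre_of_isOpen isOpen_univ univ_nonempty ((hmea.union hbad).mono ?_)
    intro g _
    by_contra hg
    simp only [mem_union, mem_iUnion, not_or, not_exists] at hg
    obtain ⟨hg1, hg2⟩ := hg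
    refine hg1 (mem_orbitOver_of_sub_mem_iff hlt hinf (hA.union hB) fun d hd β => ?_)
    obtain ⟨c, hc, hac⟩ := exists_sub_mem_annih hlt a A
    rcases lt_or_ge β (depRank lev a A) with hβ | hβ
    · refine iff_of_false (fun h => ?_) fun h => hg2 β hβ d hd h
      exact absurd (depRank_le hd h) (not_le.2 (heq ▸ hβ))
    · have h1 : a - c ∈ annih p lev β := annih_mono hβ hac
      have h2 : (g : FilteredAut p lev) • a - c ∈ annih p lev β :=
        (smul_sub_mem_annih_iff g.2 hc).2 h1
      rw [← sub_add_sub_cancel a c d, ← sub_add_sub_cancel ((g : FilteredAut p lev) • a) c d,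
        Submodule.add_mem_iff_right _ h1, Submodule.add_mem_iff_right _ h2]

/-- Dependent extensions strictly lower `depRank`, and one further parameter realizes each smaller
value. -/
theorem nmGe_iff (hlt : ∀ k, lev k < α) (hinf : ∀ β < α, {k | lev k = β}.Infinite)
    {a : I → ZMod p} {A : Set (I → ZMod p)} (hA : A.Finite) {β : Ordinal.{0}} :
    NMGe (FilteredAut p lev) a β A ↔ β ≤ depRank lev a A := by
  induction β using WellFoundedLT.induction generalizing A with
  | ind β ih =>
    rw [NMGe]
    constructor
    · intro h
      refine le_of_forall_lt fun γ hγ => ?_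
      obtain ⟨B, hB, hAB, hdep, hge⟩ := h γ hγ
      rw [nmIndep_iff hlt hinf hA hB, union_eq_self_of_subset_left hAB] at hdep
      exact ((ih γ hγ hB).1 hge).trans_lt (lt_of_le_of_ne (depRank_anti hlt a hAB) hdep)
    · intro h γ hγ
      obtain ⟨b, hb⟩ := exists_depRank_insert_eq hlt hinf hA (hγ.trans_le h)
      refine ⟨insert b A, hA.insert b, subset_insert b A, ?_, (ih γ hγ (hA.insert b)).2 hb.ge⟩
      rw [nmIndep_iff hlt hinf hA (hA.insert b), union_eq_self_of_subset_left (subset_insert b A),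
        hb]
      exact (hγ.trans_le h).ne

theorem nm_eq (hlt : ∀ k, lev k < α) (hinf : ∀ β < α, {k | lev k = β}.Infinite)
    (a : I → ZMod p) {A : Set (I → ZMod p)} (hA : A.Finite) :
    NM (FilteredAut p lev) a A = (depRank lev a A : WithTop Ordinal.{0}) := by
  refine le_antisymm (sSup_le ?_) (le_NM_iff.2 ((nmGe_iff hlt hinf hA).2 le_rfl))
  rintro _ ⟨β, hβ, rfl⟩
  exact WithTop.coe_le_coe.2 ((nmGe_iff hlt hinf hA).1 hβ)

theorem nmSpace_eq (hlt : ∀ k, lev k < α) (hinf : ∀ β < α, {k | lev k = β}.Infinite) :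
    NMSpace (FilteredAut p lev) (I → ZMod p) = (α : WithTop Ordinal.{0}) := by
  refine le_antisymm (iSup_le fun x => ?_) ?_
  · rw [nm_eq hlt hinf x finite_empty]
    exact WithTop.coe_le_coe.2 (depRank_le_top hlt x ∅)
  · obtain ⟨x, -, hx⟩ := exists_generic (p := p) hinf finite_empty le_rfl
    refine le_iSup_of_le x ?_
    rw [nm_eq hlt hinf x finite_empty]
    refine WithTop.coe_le_coe.2 (le_of_not_gt fun hlt' => ?_)
    obtain ⟨c, hc, hxc⟩ := exists_sub_mem_annih hlt x ∅
    exact hx _ hlt' c hc hxc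

/-- An orbit is determined by the map taking each coefficient vector to the least `β ≤ α` with the
combination in `H_β`. The domain is finite and the codomain countable. -/
theorem isSmall (hlt : ∀ k, lev k < α) (hinf : ∀ β < α, {k | lev k = β}.Infinite) :
    IsSmall (FilteredAut p lev) (I → ZMod p) := by
  intro n
  let r : (Fin n → I → ZMod p) → (Fin n → ZMod p) → Ordinal.{0} :=
    fun a c => sInf {β | ∑ i, c i • a i ∈ annih p lev β}
  have hr : ∀ a c β, ∑ i, c i • a i ∈ annih p lev β ↔ r a c ≤ β := by
    intro a c β
    refine ⟨fun h => csInf_le' h, fun h => annih_mono h ?_⟩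
    exact csInf_mem (s := {β | ∑ i, c i • a i ∈ annih p lev β}) ⟨α, mem_annih_top hlt _⟩
  have hsame : ∀ a a', r a = r a' ↔ SameType lev a a' := by
    intro a a'
    constructor
    · intro h c β
      rw [hr, hr, h]
    · intro h
      funext c
      simp only [r]
      congr 1
      ext β
      exact h c β
  have : Countable (Iic α) := (countable_Iic_of_infinite_fibers hinf).to_subtype
  let R : MulAction.orbitRel.Quotient (FilteredAut p lev) (Fin n → I → ZMod p) →
      (Fin n → ZMod p) → Iic α :=
    fun q c => ⟨r q.out c, (hr _ _ _).1 (mem_annih_top hlt _)⟩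
  refine Function.Injective.countable (f := R) fun q q' hqq' => ?_
  have h : r q.out = r q'.out := funext fun c => congrArg Subtype.val (congrFun hqq' c)
  obtain ⟨g, hg⟩ := ((hsame _ _).1 h).symm.exists_smul_eq hlt hinf
  rw [← Quotient.out_eq q, ← Quotient.out_eq q']
  exact Quotient.sound ⟨g, funext hg⟩

end Rank

end FilteredDual

/-! ### Constant tuples -/

namespace PolishStr

theorem nmGe_const {G : Type v} {X : Type u} [Group G] [TopologicalSpace G] [MulAction G X]
    {ι : Type} [Nonempty ι] {x : X} {A : Set X} {β : Ordinal.{u}} :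
    NMGe G (fun _ : ι => x) β A ↔ NMGe G x β A := by
  have hind : ∀ A B : Set X, NMIndep G (fun _ : ι => x) A B ↔ NMIndep G x A B := by
    intro A B
    have : ∀ g : fixingSubgroup G A, (g : G) • (fun _ : ι => x) ∈
        orbitOver G (fun _ : ι => x) (A ∪ B) ↔ (g : G) • x ∈ orbitOver G x (A ∪ B) := by
      intro g
      refine exists_congr fun h => and_congr_right fun _ => ?_
      simp [funext_iff]
    simp only [NMIndep, this]
  induction β using WellFoundedLT.induction generalizing A with
  | ind β ih =>
    rw [NMGe, NMGe]
    refine forall₂_congr fun γ hγ => exists_congr fun B => ?_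
    simp only [hind, ih γ hγ]

/-- The rank of a constant tuple is the rank of its entry. -/
theorem nm_const {G : Type v} {X : Type u} [Group G] [TopologicalSpace G] [MulAction G X]
    {ι : Type} [Nonempty ι] {x : X} {A : Set X} :
    NM G (fun _ : ι => x) A = NM G x A := by
  simp only [NM, nmGe_const]

end PolishStr

/-! ### The index set `α × ω` and the two counterexamples -/

open FilteredDual in
theorem PolishStr.exists_compact_G_group_of_rank (α : Ordinal.{0}) (hα : α < ω₁) (p : ℕ)
    (hp : p.Prime) :
    ∃ (H G : Type) (_ : AddCommGroup H) (_ : TopologicalSpace H) (_ : Group G)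
      (_ : TopologicalSpace G) (_ : DistribMulAction G H),
      PolishStr.IsCompactGGroup G H ∧
      PolishStr.IsSmall G H ∧
      PolishStr.IsNMStable G H ∧
      PolishStr.NMSpace G H = (α : WithTop Ordinal.{0}) ∧
      (0 < α → Nonempty (H ≃ₜ+ (ℕ → ZMod p))) ∧
      ∃ K : Set.Iic α → AddSubgroup H,
        (∀ i, PolishStr.IsEmptyClosed G (K i)) ∧
        ∀ i j, i < j → PolishStr.NwdSubgroup (K i) (K j) := by
  have : Fact p.Prime := ⟨hp⟩
  have hc : Countable α.ToType := by
    rw [← Cardinal.mk_le_aleph0_iff, Cardinal.mk_toType]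
    rwa [← Order.lt_succ_iff, ← Cardinal.aleph_zero, Cardinal.succ_aleph, zero_add,
      ← Cardinal.lt_ord, Cardinal.ord_aleph]
  let lev : α.ToType × ℕ → Ordinal.{0} := fun k => k.1.toOrd.1
  have hlt : ∀ k, lev k < α := fun k => k.1.toOrd.2
  have hinf : ∀ β < α, {k | lev k = β}.Infinite := by
    intro β hβ
    refine (Set.infinite_range_of_injective
      (f := fun n : ℕ => (Ordinal.ToType.mk ⟨β, hβ⟩, n)) fun m n h => (Prod.ext_iff.1 h).2).mono ?_
    rintro _ ⟨n, rfl⟩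
    simp [lev]
  have hspace := nmSpace_eq (p := p) hlt hinf
  refine ⟨α.ToType × ℕ → ZMod p, FilteredAut p lev, inferInstance, inferInstance, inferInstance,
    inferInstance, inferInstance, isCompactGGroup, isSmall hlt hinf, ?_, hspace, fun h0 => ?_,
    fun i => (annih p lev i.1).toAddSubgroup, fun i => isEmptyClosed_annih i.1,
    fun i j hij => nwdSubgroup_annih hinf hij j.2⟩
  · rw [PolishStr.IsNMStable, hspace]
    exact WithTop.coe_lt_top α
  · have : Nonempty α.ToType := Ordinal.nonempty_toType_iff.2 h0.ne'
    obtain ⟨e⟩ := nonempty_equiv_of_countable (α := α.ToType × ℕ) (β := ℕ)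
    exact ⟨{ Homeomorph.piCongrLeft (Y := fun _ => ZMod p) e with
      map_add' := fun x y => by
        funext n
        obtain ⟨k, rfl⟩ := e.surjective n
        simp [Homeomorph.piCongrLeft] }⟩

theorem theorem3p3 :
    (∀ α : Ordinal.{0}, α < ω₁ → ∀ p : ℕ, p.Prime →
      ∃ (H G : Type) (_ : AddCommGroup H) (_ : TopologicalSpace H) (_ : Group G)
        (_ : TopologicalSpace G) (_ : DistribMulAction G H),
        PolishStr.IsCompactGGroup G H ∧
        PolishStr.IsSmall G H ∧
        PolishStr.IsNMStable G H ∧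
        PolishStr.NMSpace G H = (α : WithTop Ordinal.{0}) ∧
        (0 < α → Nonempty (H ≃ₜ+ (ℕ → ZMod p))) ∧
        ∃ K : Set.Iic α → AddSubgroup H,
          (∀ i, PolishStr.IsEmptyClosed G (K i)) ∧
          ∀ i j, i < j → PolishStr.NwdSubgroup (K i) (K j)) ∧
    ¬ PolishStr.NMGapConjecture ∧
    ¬ PolishStr.EmptyClosedACC := by
  have hω : ω < ω₁ := Ordinal.omega0_lt_omega_one
  refine ⟨PolishStr.exists_compact_G_group_of_rank, fun hgap => ?_, fun hacc => ?_⟩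
  -- With `ω + 1`, a supremum strictly above `ω` already yields an element of rank above `ω`,
  -- whether or not it is attained.
  · obtain ⟨H, G, _, _, _, _, _, hG, hsmall, hstable, hrank, -⟩ :=
      PolishStr.exists_compact_G_group_of_rank (Order.succ ω)
        ((Cardinal.isSuccLimit_omega 1).succ_lt hω) 2 Nat.prime_two
    have hlt : ((ω : Ordinal.{0}) : WithTop Ordinal.{0}) < PolishStr.NMSpace G H := by
      rw [hrank]
      exact WithTop.coe_lt_coe.2 (Order.lt_succ ω)
    obtain ⟨x, hx⟩ := lt_iSup_iff.1 hlt
    have hle : PolishStr.NM G x (∅ : Set H) ≤ PolishStr.NMSpace G H :=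
      le_iSup (fun x : H => PolishStr.NM G x (∅ : Set H)) x
    rcases hgap H G hG hsmall hstable 1 (fun _ => x) ∅ Set.finite_empty with h | h
    · rw [PolishStr.nm_const] at h
      exact lt_asymm h hx
    · rw [PolishStr.nm_const] at h
      exact absurd (h ▸ hle) (not_le.2 hstable)
  · obtain ⟨H, G, _, _, _, _, _, hG, hsmall, hstable, -, -, K, hK, hnwd⟩ :=
      PolishStr.exists_compact_G_group_of_rank ω hω 2 Nat.prime_two
    let i : ℕ → Set.Iic (ω : Ordinal.{0}) := fun n => ⟨n, (Ordinal.natCast_lt_omega0 n).le⟩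
    have hi : StrictMono i := fun m n hmn => by
      simpa [i, ← Subtype.coe_lt_coe] using hmn
    obtain ⟨N, hN⟩ := hacc H G hG hsmall hstable (fun n => K (i n))
      (monotone_nat_of_le_succ fun n => (hnwd _ _ (hi n.lt_succ_self)).1) fun n => hK _
    have h := (hnwd _ _ (hi N.lt_succ_self)).2
    rw [hN (N + 1) N.le_succ] at h
    -- If the chain stopped, `K (i N)` would be nowhere dense in itself, impossible for a nonempty
    -- space.
    have huniv : {x : K (i N) | (x : H) ∈ K (i N)} = Set.univ :=
      Set.eq_univ_of_forall fun x => x.2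
    rw [huniv, IsNowhereDense, closure_univ, interior_univ] at h
    exact Set.univ_nonempty.ne_empty h
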